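/- Cut-Set Outer Bound. Let $\mathcal{T}$ be a finite tree with nodes $v_0,\dots,v_n$ and root (sink) $v_0$. For $i\neq 0$ let $v_{\mathrm{PN}(i)}$ be the parent of $v_i$, i.e. its neighbour on the path to $v_0$, and let $\mathcal{S}_i$ be the set that consists of $v_i$ and all its descendants. Let $N\ge 1$, let the nodes observe independent vectors $\mathbf{x}_i\sim\mathcal{N}(\mathbf{0}_N,\mathbf{I}_N)$, and let $w_i$ be real weights. For a set $\mathcal{S}$ of nodes put $\mathbf{y}_{\mathcal{S}}=\sum_{v_j\in\mathcal{S}}w_j\mathbf{x}_j$ and $\sigma_{\mathcal{S}}^2=\sum_{v_j\in\mathcal{S}}w_j^2$. Besides its observation, each node may generate random data; the random data of all nodes together are independent of the observations. A feasible oblivious distributed computation scheme consists of a finite number $T$ of time slots, and, for each slot $t$, of a transmitting node $v(t)$, an edge $e(t)$ at $v(t)$, a measurable mapping $f_t$ and a measurable encoding mapping $g_t$ with values in the binary sequences of a finite length $\ell_t$. All of these are fixed in advance and do not depend on the data. In slot $t$ the node $v(t)$ applies $f_t$ to its observation, its random data and the messages that it received in earlier slots, and sends the $\ell_t$ bits $g_t(f_t)$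 along $e(t)$. The sum rate is $R=\frac1N\sum_{t=1}^T\ell_t$. Let $I_j$ be all the information available at $v_j$ at the end: its observation, its random data and all the messages that it received. For $i\neq0$ let $$D_i^{\mathrm{Rx}}=\frac1N\,\mathbb{E}\Big[\big\|\mathbf{y}_{\mathcal{S}_i}-\mathbb{E}[\mathbf{y}_{\mathcal{S}_i}\mid I_{\mathrm{PN}(i)}]\big\|_2^2\Big]$$ be the MMSE distortion with which the parent of $v_i$ estimates $\mathbf{y}_{\mathcal{S}_i}$. Then for every feasible oblivious distributed computation scheme $D_i^{\mathrm{Rx}}>0$ for every $i\ne 0$ with $\sigma_{\mathcal{S}_i}^2>0$, and $$R\;\ge\;\frac12\sum_{i=1}^n\log_2\frac{\sigma_{\mathcal{S}_i}^2}{D_i^{\mathrm{Rx}}},$$ where terms with $\sigma_{\mathcal{S}_i}^2=0$ (for which also $D_i^{\mathrm{Rx}}=0$) are read as $0$. -/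

import Mathlib

open MeasureTheory ProbabilityTheory

namespace TreeAggregation

/-! ### Rooted trees -/

section Tree

variable {V : Type*} {G : SimpleGraph V}

/-- The unique path from `i` to `j` in a tree. -/
noncomputable def treePath (hG : G.IsTree) (i j : V) : G.Walk i j :=
  (hG.existsUnique_path i j).choose

/-- The parent of `i` in the tree rooted at `r`: the neighbour of `i` on the path from `i` to `r`
(only used for `i ≠ r`). -/
noncomputable def parent (hG : G.IsTree) (r i : V) : V :=
  (treePath hG i r).snd

open Classical in
/-- The set that consists of `i` and all its descendants in the tree rooted at `r`: the nodes `j`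
such that `i` lies on the path from `j` to `r`. -/
noncomputable def subtree [Fintype V] (hG : G.IsTree) (r i : V) : Finset V :=
  {j : V | i ∈ (treePath hG j r).support}

end Tree

/-! ### Distributed computation schemes -/

/-- A feasible oblivious distributed computation scheme on the network `G`, with blocklength `N` and
with random data generated at node `v` taking values in `𝓤 v`. The number `T` of time slots, the
transmitting nodes, the edges and the numbers of bits do not depend on the inputs. In slot `t` the
node `sender t` applies the real (vector-valued) mapping `f t` to its own observation, its own
random data and the messages that it received in earlier slots, encodes the result by `g t` into a
binary sequence of length `len t`, and sends that sequence to its neighbour `receiver t`. -/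
structure Scheme {V : Type*} (G : SimpleGraph V) (N : ℕ) (𝓤 : V → Type*)
    [∀ v, MeasurableSpace (𝓤 v)] where
  T : ℕ
  sender : Fin T → V
  receiver : Fin T → V
  adj : ∀ t, G.Adj (sender t) (receiver t)
  dim : Fin T → ℕ
  len : Fin T → ℕ
  f : ∀ t : Fin T,
    EuclideanSpace ℝ (Fin N) × 𝓤 (sender t) ×
      (∀ s : {s : Fin T // s < t ∧ receiver s = sender t}, Fin (len s.1) → Bool) →
    (Fin (dim t) → ℝ)
  measurable_f : ∀ t, Measurable (f t)
  g : ∀ t : Fin T, (Fin (dim t) → ℝ) → (Fin (len t) → Bool)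
  measurable_g : ∀ t, Measurable (g t)

namespace Scheme

variable {V : Type*} {G : SimpleGraph V} {N : ℕ} {𝓤 : V → Type*} [∀ v, MeasurableSpace (𝓤 v)]

/-- The bits transmitted in slot `t` when the observations are `x` and the random data are `u`. -/
def message (P : Scheme G N 𝓤) (x : V → EuclideanSpace ℝ (Fin N)) (u : ∀ v, 𝓤 v)
    (t : Fin P.T) : Fin (P.len t) → Bool :=
  P.g t (P.f t (x (P.sender t), u (P.sender t), fun s => P.message x u s.1))
termination_by t
decreasing_by exact s.2.1

/-- All the information available at node `v` at the end: its observation, its random data, and all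
the messages that it received. -/
def info (P : Scheme G N 𝓤) (v : V) (x : V → EuclideanSpace ℝ (Fin N)) (u : ∀ v, 𝓤 v) :
    EuclideanSpace ℝ (Fin N) × 𝓤 v ×
      (∀ s : {s : Fin P.T // P.receiver s = v}, Fin (P.len s.1) → Bool) :=
  (x v, u v, fun s => P.message x u s.1)

/-- The sum rate: the total number of transmitted bits, divided by the blocklength. -/
noncomputable def sumRate (P : Scheme G N 𝓤) : ℝ :=
  (∑ t, (P.len t : ℝ)) / N

end Scheme

/-! ### Partial sums and distortions -/

section Distortion

variable {V : Type*} {G : SimpleGraph V} {N : ℕ} {𝓤 : V → Type*} [∀ v, MeasurableSpace (𝓤 v)]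
  {Ω : Type*} [MeasurableSpace Ω]

/-- The weighted partial sum over `S` of the observations. -/
noncomputable def partialSum (w : V → ℝ) (X : V → Ω → EuclideanSpace ℝ (Fin N)) (S : Finset V) :
    Ω → EuclideanSpace ℝ (Fin N) :=
  fun ω => ∑ j ∈ S, w j • X j ω

/-- The variance of each entry of the partial sum over `S`. -/
def sumVar (w : V → ℝ) (S : Finset V) : ℝ :=
  ∑ j ∈ S, w j ^ 2

/-- The MMSE estimate of the partial sum over `S` at node `v`: its conditional expectation given all
the information available at `v` at the end. -/
noncomputable def mmseEstimate (μ : Measure Ω) (w : V → ℝ)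
    (X : V → Ω → EuclideanSpace ℝ (Fin N)) (U : ∀ v, Ω → 𝓤 v) (P : Scheme G N 𝓤)
    (S : Finset V) (v : V) : Ω → EuclideanSpace ℝ (Fin N) :=
  μ[partialSum w X S |
    MeasurableSpace.comap (fun ω => P.info v (fun j => X j ω) (fun j => U j ω)) inferInstance]

/-- The normalized mean-square error with which the parent of `i` estimates the partial sum over
the subtree of `i`. -/
noncomputable def distRx [Fintype V] (μ : Measure Ω) (hG : G.IsTree) (r : V) (w : V → ℝ)
    (X : V → Ω → EuclideanSpace ℝ (Fin N)) (U : ∀ v, Ω → 𝓤 v) (P : Scheme G N 𝓤) (i : V) : ℝ :=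
  (1 / N : ℝ) * ∫ ω, ‖partialSum w X (subtree hG r i) ω -
    mmseEstimate μ w X U P (subtree hG r i) (parent hG r i) ω‖ ^ 2 ∂μ

end Distortion

end TreeAggregation

open TreeAggregation

/-! Removing the edge from `i` to its parent separates the subtree `S` of `i` from the other nodes.
Everything the parent learns is then a function of the observations outside `S` and the random data,
which are independent of `y_S`, and of the `b` bits sent across the cut. For fixed values of these
bits the estimate `c` of `y_S` is independent of `y_S`, so that
`exp (‖y_S‖² / 2σ² - ‖y_S - c‖² / 2t)` has an explicit Gaussian expectation. Summing over the
`2 ^ b` values and applying Jensen's inequality to the exponential yields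
`N / 2 * (1 + log (σ² / t)) ≤ b * log 2 + N * D / 2t` for every `t > 0`. Letting `t → 0` shows that
`D > 0`, and `t = D` gives `N / 2 * log₂ (σ² / D) ≤ b`. Only `i` itself transmits from its subtree
to the outside, so no slot crosses the cuts of two different nodes, and these bounds add up. -/

namespace TreeAggregation

section FiniteSideInformation

variable {Ω α ζ β : Type*} [MeasurableSpace Ω] [MeasurableSpace α] [MeasurableSpace ζ] [Fintype β]
  {μ : Measure Ω} [IsProbabilityMeasure μ] {Y : Ω → α} {Z : Ω → ζ}

lemma lintegral_le_card_mul_of_indepFun (hY : AEMeasurable Y μ) (hZ : AEMeasurable Z μ)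
    (hYZ : IndepFun Y Z μ) (B : Ω → β) {F : β → α × ζ → ENNReal} (hF : ∀ b, Measurable (F b))
    {C : ENNReal} (hC : ∀ b z, ∫⁻ y, F b (y, z) ∂(μ.map Y) ≤ C) :
    ∫⁻ ω, F (B ω) (Y ω, Z ω) ∂μ ≤ Fintype.card β * C := by
  have := Measure.isProbabilityMeasure_map hZ
  have hslice (b : β) : ∫⁻ ω, F b (Y ω, Z ω) ∂μ ≤ C := by
    rw [← lintegral_map' (hF b).aemeasurable (hY.prodMk hZ), hYZ.map_prod_eq_prod_map_map hY hZ,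
      lintegral_prod_symm _ (hF b).aemeasurable]
    exact (lintegral_mono (hC b)).trans (by simp)
  calc ∫⁻ ω, F (B ω) (Y ω, Z ω) ∂μ
      ≤ ∫⁻ ω, ∑ b, F b (Y ω, Z ω) ∂μ := lintegral_mono fun ω =>
        Finset.single_le_sum (f := fun b => F b (Y ω, Z ω)) (fun _ _ => zero_le)
          (Finset.mem_univ (B ω))
    _ = ∑ b, ∫⁻ ω, F b (Y ω, Z ω) ∂μ :=
        lintegral_finsetSum' _ fun b _ => (hF b).comp_aemeasurable (hY.prodMk hZ)
    _ ≤ ∑ _b : β, C := Finset.sum_le_sum fun b _ => hslice b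
    _ = Fintype.card β * C := by simp

lemma integral_le_log_of_lintegral_exp_le {f : Ω → ℝ} (hf : Integrable f μ) {K : ℝ} (hK : 0 < K)
    (hexp : ∫⁻ ω, ENNReal.ofReal (Real.exp (f ω)) ∂μ ≤ ENNReal.ofReal K) :
    ∫ ω, f ω ∂μ ≤ Real.log K := by
  have hnonneg : 0 ≤ᵐ[μ] fun ω => Real.exp (f ω) := ae_of_all _ fun _ => (Real.exp_pos _).le
  have hmeas : AEStronglyMeasurable (fun ω => Real.exp (f ω)) μ :=
    Real.continuous_exp.comp_aestronglyMeasurable hf.1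
  have hint : Integrable (fun ω => Real.exp (f ω)) μ :=
    ⟨hmeas, (hasFiniteIntegral_iff_ofReal hnonneg).2 (hexp.trans_lt ENNReal.ofReal_lt_top)⟩
  rw [Real.le_log_iff_exp_le hK]
  calc Real.exp (∫ ω, f ω ∂μ)
      ≤ ∫ ω, Real.exp (f ω) ∂μ := convexOn_exp.map_integral_le Real.continuous_exp.continuousOn
        isClosed_univ (by simp) hf hint
    _ ≤ K := by
        rw [integral_eq_lintegral_of_nonneg_ae hnonneg hmeas]
        exact ENNReal.toReal_le_of_le_ofReal hK.le hexp

lemma integral_le_log_card_add_log_of_indepFun (hY : AEMeasurable Y μ) (hZ : AEMeasurable Z μ)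
    (hYZ : IndepFun Y Z μ) (B : Ω → β) {φ : β → α × ζ → ℝ} (hφ : ∀ b, Measurable (φ b))
    (hint : Integrable (fun ω => φ (B ω) (Y ω, Z ω)) μ) {K : ℝ} (hK : 0 < K)
    (hφK : ∀ b z, ∫⁻ y, ENNReal.ofReal (Real.exp (φ b (y, z))) ∂(μ.map Y) ≤ ENNReal.ofReal K) :
    ∫ ω, φ (B ω) (Y ω, Z ω) ∂μ ≤ Real.log (Fintype.card β) + Real.log K := by
  obtain ⟨ω₀⟩ : Nonempty Ω := nonempty_of_isProbabilityMeasure μ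
  have hcard : (0 : ℝ) < Fintype.card β := by exact_mod_cast Fintype.card_pos_iff.2 ⟨B ω₀⟩
  rw [← Real.log_mul hcard.ne' hK.ne']
  refine integral_le_log_of_lintegral_exp_le hint (by positivity) ?_
  rw [ENNReal.ofReal_mul hcard.le, ENNReal.ofReal_natCast]
  exact lintegral_le_card_mul_of_indepFun hY hZ hYZ B
    (F := fun b p => ENNReal.ofReal (Real.exp (φ b p))) (fun b => (hφ b).exp.ennreal_ofReal) hφK

end FiniteSideInformation

section StdGaussian

variable {E : Type*} [NormedAddCommGroup E] [InnerProductSpace ℝ E] [FiniteDimensional ℝ E]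
  [MeasurableSpace E] [BorelSpace E]

lemma integral_norm_sq_stdGaussian : ∫ x, ‖x‖ ^ 2 ∂(stdGaussian E) = Module.finrank ℝ E := by
  set b := stdOrthonormalBasis ℝ E
  have hcoord (i) : ∫ x, (inner ℝ (b i) x) ^ 2 ∂(stdGaussian E) = 1 := by
    have h := variance_dual_stdGaussian (innerSL ℝ (b i))
    rw [variance_of_integral_eq_zero (by fun_prop) (integral_strongDual_stdGaussian _)] at h
    simpa using h
  have hint (i) : Integrable (fun x => (inner ℝ (b i) x) ^ 2) (stdGaussian E) :=
    (IsGaussian.memLp_two_id.const_inner (b i)).integrable_sq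
  simp_rw [← b.sum_sq_inner_right]
  rw [integral_finsetSum _ fun i _ => hint i]
  simp [hcoord]

lemma integral_exp_sq_sub_gaussianReal {σ t : ℝ} (hσ : 0 < σ) (ht : 0 < t) (c : ℝ) :
    ∫ x, Real.exp (x ^ 2 / 2 - (σ * x - c) ^ 2 / (2 * t)) ∂(gaussianReal 0 1) = √t / σ := by
  have hdensity (x : ℝ) : gaussianPDFReal 0 1 x •
      Real.exp (x ^ 2 / 2 - (σ * x - c) ^ 2 / (2 * t)) =
      (√(2 * Real.pi))⁻¹ * Real.exp (-(σ ^ 2 / (2 * t)) * (x - c / σ) ^ 2) := by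
    simp only [gaussianPDFReal_def, smul_eq_mul, mul_assoc, ← Real.exp_add, NNReal.coe_one,
      mul_one, sub_zero]
    congr 2
    field_simp
    ring
  have hconst : Real.pi / (σ ^ 2 / (2 * t)) = 2 * Real.pi * (√t / σ) ^ 2 := by
    rw [div_pow, Real.sq_sqrt ht.le]
    field_simp
  simp_rw [integral_gaussianReal_eq_integral_smul one_ne_zero, hdensity]
  rw [integral_const_mul, integral_sub_right_eq_self
    (fun x => Real.exp (-(σ ^ 2 / (2 * t)) * x ^ 2)), integral_gaussian, hconst,
    Real.sqrt_mul (x := 2 * Real.pi) (by positivity), Real.sqrt_sq (by positivity),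
    inv_mul_cancel_left₀ (by positivity)]

lemma integral_exp_norm_sq_sub_stdGaussian {σ t : ℝ} (hσ : 0 < σ) (ht : 0 < t) (c : E) :
    ∫ x, Real.exp (‖x‖ ^ 2 / 2 - ‖σ • x - c‖ ^ 2 / (2 * t)) ∂(stdGaussian E) =
      (√t / σ) ^ Module.finrank ℝ E := by
  set b := stdOrthonormalBasis ℝ E
  have hcoord (x : E) : Real.exp (‖x‖ ^ 2 / 2 - ‖σ • x - c‖ ^ 2 / (2 * t)) =
      ∏ i, Real.exp ((inner ℝ (b i) x) ^ 2 / 2 -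
        (σ * inner ℝ (b i) x - inner ℝ (b i) c) ^ 2 / (2 * t)) := by
    rw [← Real.exp_sum, Finset.sum_sub_distrib, ← Finset.sum_div, ← Finset.sum_div,
      ← b.sum_sq_inner_right x, ← b.sum_sq_inner_right (σ • x - c)]
    simp_rw [inner_sub_right, real_inner_smul_right]
  simp_rw [hcoord]
  rw [stdGaussian_eq_map_pi_orthonormalBasis b,
    integral_map (Measurable.aemeasurable (by fun_prop)) (by fun_prop)]
  simp_rw [b.orthonormal.inner_right_fintype]
  rw [integral_fintype_prod_eq_prod
    (f := fun i x => Real.exp (x ^ 2 / 2 - (σ * x - inner ℝ (b i) c) ^ 2 / (2 * t)))]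
  simp [integral_exp_sq_sub_gaussianReal hσ ht, div_pow]

lemma lintegral_exp_norm_sq_sub_stdGaussian {σ t : ℝ} (hσ : 0 < σ) (ht : 0 < t) (c : E) :
    ∫⁻ x, ENNReal.ofReal (Real.exp (‖x‖ ^ 2 / 2 - ‖σ • x - c‖ ^ 2 / (2 * t))) ∂(stdGaussian E) =
      ENNReal.ofReal ((√t / σ) ^ Module.finrank ℝ E) := by
  have h := integral_exp_norm_sq_sub_stdGaussian hσ ht c
  have hint : Integrable (fun x => Real.exp (‖x‖ ^ 2 / 2 - ‖σ • x - c‖ ^ 2 / (2 * t)))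
      (stdGaussian E) := not_imp_comm.1 integral_undef (h ▸ by positivity)
  rw [← ofReal_integral_eq_lintegral_ofReal hint (ae_of_all _ fun _ => (Real.exp_pos _).le), h]

variable {Ω : Type*} [MeasurableSpace Ω] {μ : Measure Ω} {Y : Ω → E} {σ : ℝ}

lemma memLp_two_of_hasLaw_map_smul (hY : HasLaw Y ((stdGaussian E).map (σ • ·)) μ) :
    MemLp Y 2 μ := by
  refine MemLp.comp_of_map (g := id) ?_ hY.aemeasurable
  rw [hY.map_eq, memLp_map_measure_iff (by fun_prop) (by fun_prop)]
  exact IsGaussian.memLp_two_id.const_smul σ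

lemma integral_norm_sq_of_hasLaw_map_smul (hY : HasLaw Y ((stdGaussian E).map (σ • ·)) μ) :
    ∫ ω, ‖Y ω‖ ^ 2 ∂μ = σ ^ 2 * Module.finrank ℝ E := by
  rw [← Function.comp_def (fun y : E => ‖y‖ ^ 2) Y, hY.integral_comp (by fun_prop),
    integral_map (by fun_prop) (by fun_prop)]
  simp_rw [norm_smul, mul_pow, Real.norm_eq_abs, sq_abs, integral_const_mul,
    integral_norm_sq_stdGaussian]

end StdGaussian

section ShannonLowerBound

lemma pos_and_mul_log_div_le_of_forall {n M v L : ℝ} (hn : 0 < n) (hM : 0 ≤ M) (hv : 0 < v)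
    (h : ∀ t, 0 < t → n / 2 * (1 + Real.log (v / t)) ≤ L + M / (2 * t)) :
    0 < M ∧ n / 2 * Real.log (v / (M / n)) ≤ L := by
  have hMpos : 0 < M := by
    refine hM.lt_of_ne fun h0 => ?_
    have ht := h (v / Real.exp (2 * L / n)) (by positivity)
    rw [div_div_cancel₀ hv.ne', Real.log_exp, ← h0, zero_div, add_zero] at ht
    have : n / 2 * (1 + 2 * L / n) = n / 2 + L := by field_simp
    linarith
  refine ⟨hMpos, ?_⟩
  have ht := h (M / n) (by positivity)
  have : M / (2 * (M / n)) = n / 2 := by field_simp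
  linarith

variable {E : Type*} [NormedAddCommGroup E] [InnerProductSpace ℝ E] [FiniteDimensional ℝ E]
  [MeasurableSpace E] [BorelSpace E] {Ω ζ β : Type*} [MeasurableSpace Ω] [MeasurableSpace ζ]
  [Fintype β] {μ : Measure Ω} [IsProbabilityMeasure μ] {Y : Ω → E} {Z : Ω → ζ} {B : Ω → β}
  {c : β → ζ → E} {σ : ℝ}

-- Test function `‖y‖² / 2σ² - ‖y - c‖² / 2t`: the log-likelihood ratio, up to a constant, of the
-- Gaussian law of variance `t` centred at the estimate against the law of `Y`.
lemma mul_one_add_log_div_le_log_card_add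
    (hY : HasLaw Y ((stdGaussian E).map (σ • ·)) μ) (hσ : 0 < σ) (hZ : AEMeasurable Z μ)
    (hYZ : IndepFun Y Z μ) (hc : ∀ b, Measurable (c b))
    (hint : Integrable (fun ω => ‖Y ω - c (B ω) (Z ω)‖ ^ 2) μ) {t : ℝ} (ht : 0 < t) :
    (Module.finrank ℝ E : ℝ) / 2 * (1 + Real.log (σ ^ 2 / t)) ≤
      Real.log (Fintype.card β) + (∫ ω, ‖Y ω - c (B ω) (Z ω)‖ ^ 2 ∂μ) / (2 * t) := by
  have hscale (x : E) : ‖σ • x‖ ^ 2 / (2 * σ ^ 2) = ‖x‖ ^ 2 / 2 := by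
    rw [norm_smul, mul_pow, Real.norm_eq_abs, sq_abs]
    field_simp
  have hYint : Integrable (fun ω => ‖Y ω‖ ^ 2 / (2 * σ ^ 2)) μ :=
    ((memLp_two_of_hasLaw_map_smul hY).integrable_norm_pow two_ne_zero).div_const _
  have hYmoment : ∫ ω, ‖Y ω‖ ^ 2 / (2 * σ ^ 2) ∂μ = (Module.finrank ℝ E : ℝ) / 2 := by
    rw [integral_div, integral_norm_sq_of_hasLaw_map_smul hY]
    field_simp
  have hgibbs := integral_le_log_card_add_log_of_indepFun hY.aemeasurable hZ hYZ B
    (φ := fun b p => ‖p.1‖ ^ 2 / (2 * σ ^ 2) - ‖p.1 - c b p.2‖ ^ 2 / (2 * t))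
    (fun b => by have := hc b; fun_prop) (hYint.sub (hint.div_const _))
    (K := (√t / σ) ^ Module.finrank ℝ E) (by positivity) fun b z => by
      rw [hY.map_eq, lintegral_map (by fun_prop) (by fun_prop)]
      simp_rw [hscale, lintegral_exp_norm_sq_sub_stdGaussian hσ ht, le_refl]
  rw [integral_sub hYint (hint.div_const _), hYmoment, integral_div, Real.log_pow,
    Real.log_div (by positivity) hσ.ne', Real.log_sqrt ht.le] at hgibbs
  rw [Real.log_div (by positivity) ht.ne', Real.log_pow]
  push_cast
  linarith

theorem pos_and_mul_log_div_le_log_card [Nontrivial E]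
    (hY : HasLaw Y ((stdGaussian E).map (σ • ·)) μ) (hσ : 0 < σ) (hZ : AEMeasurable Z μ)
    (hYZ : IndepFun Y Z μ) (hc : ∀ b, Measurable (c b))
    (hint : Integrable (fun ω => ‖Y ω - c (B ω) (Z ω)‖ ^ 2) μ) :
    0 < ∫ ω, ‖Y ω - c (B ω) (Z ω)‖ ^ 2 ∂μ ∧
      (Module.finrank ℝ E : ℝ) / 2 * Real.log
        (σ ^ 2 / ((∫ ω, ‖Y ω - c (B ω) (Z ω)‖ ^ 2 ∂μ) / Module.finrank ℝ E)) ≤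
      Real.log (Fintype.card β) :=
  pos_and_mul_log_div_le_of_forall (by exact_mod_cast Module.finrank_pos)
    (integral_nonneg fun _ => sq_nonneg _) (by positivity)
    fun _ ht => mul_one_add_log_div_le_log_card_add hY hσ hZ hYZ hc hint ht

end ShannonLowerBound

section Independence

variable {Ω : Type*} [MeasurableSpace Ω] {μ : Measure Ω}

lemma measurable_pi_indicator {ι E : Type*} [Zero E] [MeasurableSpace E] (s : Set ι) :
    Measurable fun x : ι → E => s.indicator x := by
  classical
  refine measurable_pi_lambda _ fun i => ?_
  simp only [Set.indicator_apply]
  split_ifs <;> fun_prop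

lemma indepFun_domRestrict_of_disjoint {ι : Type*} {𝓧 : ι → Type*} [∀ i, MeasurableSpace (𝓧 i)]
    {X : ∀ i, Ω → 𝓧 i} (hX : ∀ i, Measurable (X i)) (hX_indep : iIndepFun X μ) {S T : Set ι}
    (hST : Disjoint S T) :
    IndepFun (fun ω => S.domRestrict fun i => X i ω) (fun ω => T.domRestrict fun i => X i ω) μ := by
  have hle (A : Set ι) :
      MeasurableSpace.comap (fun ω => A.domRestrict fun i => X i ω) inferInstance ≤
        ⨆ i ∈ A, MeasurableSpace.comap (X i) inferInstance :=
    (@measurable_pi_lambda _ _ _ (_) _ _ fun i => (comap_measurable (X i.1)).mono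
      (le_iSup₂ (f := fun i (_ : i ∈ A) => MeasurableSpace.comap (X i) inferInstance) i.1 i.2)
      le_rfl).comap_le
  exact indep_of_indep_of_le_left (indep_of_indep_of_le_right
    (indep_iSup_of_disjoint (fun i => (hX i).comap_le) hX_indep hST) (hle T)) (hle S)

lemma indepFun_prodMk_right_of_prodMk_left {α β γ : Type*} [MeasurableSpace α] [MeasurableSpace β]
    [MeasurableSpace γ] [IsProbabilityMeasure μ] {A : Ω → α} {B : Ω → β} {C : Ω → γ}
    (hA : AEMeasurable A μ) (hB : AEMeasurable B μ) (hC : AEMeasurable C μ) (hAB : IndepFun A B μ)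
    (hABC : IndepFun (fun ω => (A ω, B ω)) C μ) : IndepFun A (fun ω => (B ω, C ω)) μ := by
  have := Measure.isProbabilityMeasure_map hA
  have := Measure.isProbabilityMeasure_map hB
  have := Measure.isProbabilityMeasure_map hC
  have hBC : IndepFun B C μ := hABC.comp measurable_snd measurable_id
  rw [indepFun_iff_map_prod_eq_prod_map_map hA (hB.prodMk hC), hBC.map_prod_eq_prod_map_map hB hC,
    ← (measurePreserving_prodAssoc (μ.map A) (μ.map B) (μ.map C)).map_eq,
    ← hAB.map_prod_eq_prod_map_map hA hB, ← hABC.map_prod_eq_prod_map_map (hA.prodMk hB) hC,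
    AEMeasurable.map_map_of_aemeasurable (by fun_prop) (by fun_prop)]
  rfl

end Independence

section PartialSum

variable {V : Type*} {N : ℕ} {Ω : Type*} [MeasurableSpace Ω] {μ : Measure Ω}
  {X : V → Ω → EuclideanSpace ℝ (Fin N)} {𝓤 : V → Type*} {U : ∀ v, Ω → 𝓤 v}

lemma sumVar_nonneg (w : V → ℝ) (S : Finset V) : 0 ≤ sumVar w S :=
  Finset.sum_nonneg fun _ _ => sq_nonneg _

lemma hasLaw_partialSum [IsProbabilityMeasure μ] (w : V → ℝ) (S : Finset V)
    (hX_law : ∀ v, HasLaw (X v) (stdGaussian (EuclideanSpace ℝ (Fin N))) μ)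
    (hX_indep : iIndepFun X μ) :
    HasLaw (partialSum w X S)
      ((stdGaussian (EuclideanSpace ℝ (Fin N))).map (√(sumVar w S) • ·)) μ := by
  have hX (v) : AEMeasurable (X v) μ := (hX_law v).aemeasurable
  have hwX : iIndepFun (fun v ω => w v • X v ω) μ :=
    hX_indep.comp (fun v x => w v • x) fun v => by fun_prop
  have hY : AEMeasurable (partialSum w X S) μ := by unfold partialSum; fun_prop
  have := Measure.isProbabilityMeasure_map hY
  refine ⟨hY, Measure.ext_of_charFun (funext fun s => ?_)⟩
  unfold partialSum
  rw [(hwX.restrict S).charFun_map_fun_finsetSum_eq_prod (fun v _ => by fun_prop),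
    Finset.prod_apply, charFun_map_smul, charFun_stdGaussian]
  simp_rw [charFun_map_smul_comp (hX _), (hX_law _).map_eq, charFun_stdGaussian,
    ← Complex.exp_sum]
  norm_cast
  simp only [norm_smul, mul_pow, Real.norm_eq_abs, sq_abs, Real.sq_sqrt (sumVar_nonneg w S),
    neg_div, Finset.sum_neg_distrib, ← Finset.sum_div, ← Finset.sum_mul]
  rfl

/-- The data that are independent of the observations in the cut set `S`: the observations outside
`S`, extended by `0` to `S`, together with the random data of all nodes. -/
noncomputable def exteriorData (X : V → Ω → EuclideanSpace ℝ (Fin N)) (U : ∀ v, Ω → 𝓤 v)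
    (S : Finset V) (ω : Ω) : (V → EuclideanSpace ℝ (Fin N)) × (∀ v, 𝓤 v) :=
  ((S : Set V)ᶜ.indicator fun v => X v ω, fun v => U v ω)

variable [∀ v, MeasurableSpace (𝓤 v)]

lemma measurable_exteriorData (hX : ∀ v, Measurable (X v)) (hU : ∀ v, Measurable (U v))
    (S : Finset V) : Measurable (exteriorData X U S) :=
  ((measurable_pi_indicator _).comp (measurable_pi_lambda _ hX)).prodMk (measurable_pi_lambda _ hU)

lemma indepFun_partialSum_indicator_compl (w : V → ℝ) (S : Finset V) (hX : ∀ v, Measurable (X v))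
    (hX_indep : iIndepFun X μ) :
    IndepFun (partialSum w X S) (fun ω => (S : Set V)ᶜ.indicator fun v => X v ω) μ := by
  classical
  let sumIn (x : ↥(S : Set V) → EuclideanSpace ℝ (Fin N)) := ∑ v : S, w v • x v
  let extendOut (x : ↥(S : Set V)ᶜ → EuclideanSpace ℝ (Fin N)) (v : V) :=
    if hv : v ∈ (S : Set V)ᶜ then x ⟨v, hv⟩ else 0
  have hsum : Measurable sumIn := by fun_prop
  have hext : Measurable extendOut := measurable_pi_lambda _ fun v => by
    simp only [extendOut]
    split_ifs <;> fun_prop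
  have hsum_eq : (sumIn ∘ fun ω => (S : Set V).domRestrict fun v => X v ω) = partialSum w X S :=
    funext fun ω => Finset.sum_coe_sort S fun v => w v • X v ω
  have hext_eq : (extendOut ∘ fun ω => ((S : Set V)ᶜ).domRestrict fun v => X v ω) =
      fun ω => (S : Set V)ᶜ.indicator fun v => X v ω := by
    ext ω : 1
    funext v
    simp [extendOut, Set.indicator_apply]
  rw [← hsum_eq, ← hext_eq]
  exact (indepFun_domRestrict_of_disjoint hX hX_indep disjoint_compl_right).comp hsum hext

lemma indepFun_partialSum_exteriorData [IsProbabilityMeasure μ] (w : V → ℝ) (S : Finset V)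
    (hX : ∀ v, Measurable (X v)) (hX_indep : iIndepFun X μ) (hU : ∀ v, Measurable (U v))
    (hXU : IndepFun (fun ω v => X v ω) (fun ω v => U v ω) μ) :
    IndepFun (partialSum w X S) (exteriorData X U S) μ := by
  have hX_pi : Measurable fun ω v => X v ω := measurable_pi_lambda _ hX
  have hsum : Measurable fun x : V → EuclideanSpace ℝ (Fin N) => ∑ v ∈ S, w v • x v := by fun_prop
  have hindicator : Measurable fun x : V → EuclideanSpace ℝ (Fin N) => (S : Set V)ᶜ.indicator x :=
    measurable_pi_indicator _
  exact indepFun_prodMk_right_of_prodMk_left (hsum.comp hX_pi).aemeasurable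
    (hindicator.comp hX_pi).aemeasurable (measurable_pi_lambda _ hU).aemeasurable
    (indepFun_partialSum_indicator_compl w S hX hX_indep)
    (hXU.comp (hsum.prodMk hindicator) measurable_id)

end PartialSum

namespace Scheme

variable {V : Type*} [DecidableEq V] {G : SimpleGraph V} {N : ℕ} {𝓤 : V → Type*}
  [∀ v, MeasurableSpace (𝓤 v)]

/-- The slots of `P` that cross the cut `S`, that is, in which a node in `S` transmits to a node
outside `S`. -/
def cutSlots (P : Scheme G N 𝓤) (S : Finset V) : Finset (Fin P.T) :=
  {t | P.sender t ∈ S ∧ P.receiver t ∉ S}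

/-- The number of bits that `P` sends across the cut `S`, from `S` to its complement. -/
def cutBits (P : Scheme G N 𝓤) (S : Finset V) : ℕ :=
  ∑ t ∈ P.cutSlots S, P.len t

/-- The possible contents of the messages that cross the cut `S`. -/
abbrev CutTranscript (P : Scheme G N 𝓤) (S : Finset V) : Type :=
  ∀ t : P.cutSlots S, Fin (P.len t) → Bool

/-- The bits transmitted in slot `t` when the messages that cross the cut `S` are replaced by the
transcript `b`. For nodes outside `S` this simulates `P` without the observations in `S`. -/
def messageGiven (P : Scheme G N 𝓤) (S : Finset V) (b : P.CutTranscript S)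
    (x : V → EuclideanSpace ℝ (Fin N)) (u : ∀ v, 𝓤 v) (t : Fin P.T) : Fin (P.len t) → Bool :=
  if h : t ∈ P.cutSlots S then b ⟨t, h⟩ else
    P.g t (P.f t (x (P.sender t), u (P.sender t), fun s => P.messageGiven S b x u s.1))
termination_by t
decreasing_by exact s.2.1

/-- The information available at node `v` at the end when the messages that cross the cut `S` are
replaced by the transcript `b`. -/
def infoGiven (P : Scheme G N 𝓤) (S : Finset V) (b : P.CutTranscript S) (v : V)
    (x : V → EuclideanSpace ℝ (Fin N)) (u : ∀ v, 𝓤 v) :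
    EuclideanSpace ℝ (Fin N) × 𝓤 v ×
      (∀ s : {s : Fin P.T // P.receiver s = v}, Fin (P.len s.1) → Bool) :=
  (x v, u v, fun s => P.messageGiven S b x u s.1)

variable (P : Scheme G N 𝓤)

lemma card_cutTranscript (S : Finset V) : Fintype.card (P.CutTranscript S) = 2 ^ P.cutBits S := by
  simp only [Fintype.card_pi, Fintype.card_bool, Finset.prod_const, Finset.card_univ,
    Fintype.card_fin, cutBits, ← Finset.prod_pow_eq_pow_sum]
  exact Finset.prod_coe_sort (P.cutSlots S) fun t => 2 ^ P.len t

lemma measurable_messageGiven (S : Finset V) (b : P.CutTranscript S) (t : Fin P.T) :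
    Measurable fun z : (V → EuclideanSpace ℝ (Fin N)) × (∀ v, 𝓤 v) =>
      P.messageGiven S b z.1 z.2 t := by
  induction t using WellFoundedLT.induction with
  | ind t ih =>
    simp only [messageGiven.eq_def P S b _ _ t]
    split_ifs
    · exact measurable_const
    · exact (P.measurable_g t).comp <| (P.measurable_f t).comp <|
        Measurable.prodMk (by fun_prop) <| Measurable.prodMk (by fun_prop) <|
          measurable_pi_lambda _ fun s => ih s.1 s.2.1

lemma messageGiven_eq_message {S : Finset V} {x x' : V → EuclideanSpace ℝ (Fin N)}
    (u : ∀ v, 𝓤 v) (hx : ∀ v ∉ S, x' v = x v) (t : Fin P.T)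
    (ht : P.sender t ∉ S ∨ P.receiver t ∉ S) :
    P.messageGiven S (fun t => P.message x u t) x' u t = P.message x u t := by
  induction t using WellFoundedLT.induction with
  | ind t ih =>
    rw [messageGiven]
    split_ifs with h
    · rfl
    · have hsender : P.sender t ∉ S := by
        simp only [cutSlots, Finset.mem_filter_univ] at h
        tauto
      rw [message, hx _ hsender]
      congr 4
      funext s
      exact ih s.1 s.2.1 (Or.inr (by rwa [s.2.2]))

lemma measurable_infoGiven (S : Finset V) (b : P.CutTranscript S) (v : V) :
    Measurable fun z : (V → EuclideanSpace ℝ (Fin N)) × (∀ v, 𝓤 v) =>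
      P.infoGiven S b v z.1 z.2 :=
  Measurable.prodMk (by fun_prop) <| Measurable.prodMk (by fun_prop) <|
    measurable_pi_lambda _ fun s => P.measurable_messageGiven S b s.1

lemma infoGiven_eq_info {S : Finset V} {x x' : V → EuclideanSpace ℝ (Fin N)} (u : ∀ v, 𝓤 v)
    (hx : ∀ v ∉ S, x' v = x v) {v : V} (hv : v ∉ S) :
    P.infoGiven S (fun t => P.message x u t) v x' u = P.info v x u := by
  unfold infoGiven info
  rw [hx v hv]
  congr 2
  funext s
  exact P.messageGiven_eq_message u hx s.1 (Or.inr (by rwa [s.2]))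

end Scheme

section CutSet

variable {V : Type*} {G : SimpleGraph V} {N : ℕ} {𝓤 : V → Type*} [∀ v, MeasurableSpace (𝓤 v)]
  {Ω : Type*} [MeasurableSpace Ω] {μ : Measure Ω} {w : V → ℝ}
  {X : V → Ω → EuclideanSpace ℝ (Fin N)} {U : ∀ v, Ω → 𝓤 v} {S : Finset V} {v : V}

/-- The normalized mean-square error with which the node `v` estimates the partial sum over `S`. -/
noncomputable def mmseDist (μ : Measure Ω) (w : V → ℝ) (X : V → Ω → EuclideanSpace ℝ (Fin N))
    (U : ∀ v, Ω → 𝓤 v) (P : Scheme G N 𝓤) (S : Finset V) (v : V) : ℝ :=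
  (1 / N : ℝ) * ∫ ω, ‖partialSum w X S ω - mmseEstimate μ w X U P S v ω‖ ^ 2 ∂μ

variable [DecidableEq V]

lemma exists_mmseEstimate_eq (μ : Measure Ω) (w : V → ℝ) (X : V → Ω → EuclideanSpace ℝ (Fin N))
    (U : ∀ v, Ω → 𝓤 v) (P : Scheme G N 𝓤) (hv : v ∉ S) :
    ∃ c : P.CutTranscript S → (V → EuclideanSpace ℝ (Fin N)) × (∀ v, 𝓤 v) →
        EuclideanSpace ℝ (Fin N),
      (∀ b, Measurable (c b)) ∧ mmseEstimate μ w X U P S v = fun ω =>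
        c (fun t => P.message (fun j => X j ω) (fun j => U j ω) t) (exteriorData X U S ω) := by
  obtain ⟨h, hh, hest⟩ := StronglyMeasurable.exists_eq_measurable_comp
    (stronglyMeasurable_condExp : StronglyMeasurable[MeasurableSpace.comap
      (fun ω => P.info v (fun j => X j ω) (fun j => U j ω)) inferInstance]
        (mmseEstimate μ w X U P S v))
  refine ⟨fun b z => h (P.infoGiven S b v z.1 z.2),
    fun b => hh.measurable.comp (P.measurable_infoGiven S b v), funext fun ω => ?_⟩
  have hinfo := P.infoGiven_eq_info (x := fun j => X j ω) (x' := (exteriorData X U S ω).1)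
    (fun j => U j ω) (fun j hj => Set.indicator_of_mem (by simpa using hj) fun i => X i ω) hv
  rw [mmseEstimate, hest, Function.comp_apply, ← hinfo]
  rfl

variable [IsProbabilityMeasure μ]

theorem mmseDist_pos_and_mul_log_div_le_cutBits_mul_log (hN : 0 < N) (hX : ∀ v, Measurable (X v))
    (hX_law : ∀ v, HasLaw (X v) (stdGaussian (EuclideanSpace ℝ (Fin N))) μ)
    (hX_indep : iIndepFun X μ) (hU : ∀ v, Measurable (U v))
    (hXU : IndepFun (fun ω v => X v ω) (fun ω v => U v ω) μ) (P : Scheme G N 𝓤) (hv : v ∉ S)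
    (hS : 0 < sumVar w S) :
    0 < mmseDist μ w X U P S v ∧
      N / 2 * Real.log (sumVar w S / mmseDist μ w X U P S v) ≤ P.cutBits S * Real.log 2 := by
  have : Nontrivial (EuclideanSpace ℝ (Fin N)) :=
    Module.nontrivial_of_finrank_pos (R := ℝ) (by simpa using hN)
  obtain ⟨c, hc, hest⟩ := exists_mmseEstimate_eq μ w X U P hv
  have hY := hasLaw_partialSum w S hX_law hX_indep
  have hY_memLp := memLp_two_of_hasLaw_map_smul hY
  have hint : Integrable (fun ω => ‖partialSum w X S ω - mmseEstimate μ w X U P S v ω‖ ^ 2) μ :=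
    (hY_memLp.sub (hY_memLp.condExp one_le_two)).integrable_norm_pow two_ne_zero
  rw [hest] at hint
  have hshannon := pos_and_mul_log_div_le_log_card hY (Real.sqrt_pos.2 hS)
    (measurable_exteriorData hX hU S).aemeasurable
    (indepFun_partialSum_exteriorData w S hX hX_indep hU hXU) hc hint
  rw [Real.sq_sqrt hS.le, P.card_cutTranscript, finrank_euclideanSpace_fin, Nat.cast_pow,
    Real.log_pow, Nat.cast_ofNat] at hshannon
  rw [mmseDist, hest, one_div_mul_eq_div]
  exact ⟨div_pos hshannon.1 (by exact_mod_cast hN), hshannon.2⟩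

lemma mul_logb_div_mmseDist_le_cutBits (hN : 0 < N) (hX : ∀ v, Measurable (X v))
    (hX_law : ∀ v, HasLaw (X v) (stdGaussian (EuclideanSpace ℝ (Fin N))) μ)
    (hX_indep : iIndepFun X μ) (hU : ∀ v, Measurable (U v))
    (hXU : IndepFun (fun ω v => X v ω) (fun ω v => U v ω) μ) (P : Scheme G N 𝓤) (hv : v ∉ S) :
    N / 2 * Real.logb 2 (sumVar w S / mmseDist μ w X U P S v) ≤ P.cutBits S := by
  rcases (sumVar_nonneg w S).eq_or_lt with hS | hS
  · simp [← hS]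
  · rw [Real.logb, ← mul_div_assoc, div_le_iff₀ (Real.log_pos one_lt_two)]
    exact (mmseDist_pos_and_mul_log_div_le_cutBits_mul_log hN hX hX_law hX_indep hU hXU P hv hS).2

end CutSet

section Tree

variable {V : Type*} {G : SimpleGraph V} (hG : G.IsTree)

lemma isPath_treePath (i j : V) : (treePath hG i j).IsPath :=
  (hG.existsUnique_path i j).choose_spec.1

lemma eq_treePath {i j : V} {q : G.Walk i j} (hq : q.IsPath) : q = treePath hG i j :=
  (hG.existsUnique_path i j).choose_spec.2 q hq

variable [Fintype V] {r i : V}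

lemma mem_subtree {j : V} : j ∈ subtree hG r i ↔ i ∈ (treePath hG j r).support := by
  simp [subtree]

lemma eq_of_adj_of_mem_subtree {a b : V} (hab : G.Adj a b) (ha : a ∈ subtree hG r i)
    (hb : b ∉ subtree hG r i) : a = i := by
  classical
  rw [mem_subtree] at ha hb
  have hnotMem : a ∉ (treePath hG b r).support := fun h => by
    rw [← eq_treePath hG ((isPath_treePath hG b r).dropUntil h)] at ha
    exact hb ((treePath hG b r).support_dropUntil_subset_support h ha)
  rw [← eq_treePath hG ((isPath_treePath hG b r).cons (h := hab) hnotMem),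
    SimpleGraph.Walk.support_cons, List.mem_cons] at ha
  exact (ha.resolve_right hb).symm

lemma parent_notMem_subtree (hi : i ≠ r) : parent hG r i ∉ subtree hG r i := by
  have hpath := isPath_treePath hG i r
  have htail : (treePath hG i r).tail = treePath hG (parent hG r i) r :=
    eq_treePath hG hpath.tail
  rw [mem_subtree, ← htail]
  rw [← SimpleGraph.Walk.cons_tail_eq (treePath hG i r) (SimpleGraph.Walk.not_nil_of_ne hi),
    SimpleGraph.Walk.cons_isPath_iff] at hpath
  exact hpath.2

variable {N : ℕ} {𝓤 : V → Type*} [∀ v, MeasurableSpace (𝓤 v)]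

lemma distRx_eq_mmseDist {Ω : Type*} [MeasurableSpace Ω] (μ : Measure Ω) (w : V → ℝ)
    (X : V → Ω → EuclideanSpace ℝ (Fin N)) (U : ∀ v, Ω → 𝓤 v) (P : Scheme G N 𝓤) (r i : V) :
    distRx μ hG r w X U P i = mmseDist μ w X U P (subtree hG r i) (parent hG r i) :=
  rfl

lemma sum_cutBits_subtree_le [DecidableEq V] (r : V) (P : Scheme G N 𝓤) (s : Finset V) :
    ∑ i ∈ s, P.cutBits (subtree hG r i) ≤ ∑ t, P.len t := by
  have hsub (i : V) : P.cutSlots (subtree hG r i) ⊆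
      ({t | P.sender t = i} : Finset (Fin P.T)) := fun t ht => by
    simp only [Scheme.cutSlots, Finset.mem_filter_univ] at ht ⊢
    exact eq_of_adj_of_mem_subtree hG (P.adj t) ht.1 ht.2
  calc ∑ i ∈ s, P.cutBits (subtree hG r i)
      ≤ ∑ i, P.cutBits (subtree hG r i) := Finset.sum_le_univ_sum_of_nonneg fun _ => zero_le
    _ ≤ ∑ i, ∑ t with P.sender t = i, P.len t :=
        Finset.sum_le_sum fun i _ => Finset.sum_le_sum_of_subset (hsub i)
    _ = ∑ t, P.len t := Finset.sum_fiberwise _ _ _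

end Tree

end TreeAggregation

theorem theorem3
    {V : Type*} [Fintype V] [DecidableEq V] (G : SimpleGraph V) (hG : G.IsTree) (r : V)
    (w : V → ℝ) (N : ℕ) (hN : 0 < N)
    {Ω : Type*} [MeasurableSpace Ω] (μ : Measure Ω) [IsProbabilityMeasure μ]
    (X : V → Ω → EuclideanSpace ℝ (Fin N)) (hX : ∀ v, Measurable (X v))
    (hX_law : ∀ v, HasLaw (X v) (stdGaussian (EuclideanSpace ℝ (Fin N))) μ)
    (hX_indep : iIndepFun X μ)
    (𝓤 : V → Type*) [∀ v, MeasurableSpace (𝓤 v)]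
    (U : ∀ v, Ω → 𝓤 v) (hU : ∀ v, Measurable (U v))
    (hXU : IndepFun (fun ω v => X v ω) (fun ω v => U v ω) μ)
    (P : Scheme G N 𝓤) :
    (∀ i, i ≠ r → 0 < sumVar w (subtree hG r i) → 0 < distRx μ hG r w X U P i) ∧
    P.sumRate ≥ (1 / 2 : ℝ) * ∑ i ∈ Finset.univ.erase r,
      Real.logb 2 (sumVar w (subtree hG r i) / distRx μ hG r w X U P i) := by
  simp_rw [distRx_eq_mmseDist]
  refine ⟨fun i hi hS => (mmseDist_pos_and_mul_log_div_le_cutBits_mul_log hN hX hX_law hX_indep hU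
    hXU P (parent_notMem_subtree hG hi) hS).1, ?_⟩
  have hcut := Finset.sum_le_sum fun i (hi : i ∈ Finset.univ.erase r) =>
    mul_logb_div_mmseDist_le_cutBits (w := w) hN hX hX_law hX_indep hU hXU P
      (parent_notMem_subtree hG (Finset.ne_of_mem_erase hi))
  have hbits : ∑ i ∈ Finset.univ.erase r, (P.cutBits (subtree hG r i) : ℝ) ≤ ∑ t, (P.len t : ℝ) :=
    mod_cast sum_cutBits_subtree_le hG r P _
  rw [← Finset.mul_sum] at hcut
  rw [ge_iff_le, Scheme.sumRate, le_div_iff₀ (by exact_mod_cast hN)]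
  linarith
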